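/- Let $\sigma(x)=1/(1+e^{-x})$. For an undirected graph $G=(V,E)$ with ordered node set $V$, a score vector $\theta^\star\in\mathbb R^V$ and an integer $L\ge 1$ (the number $L_{i,j}=L$ of samples on every edge), define $$L_z=\sum_{(i,j)\in E,\ i<j}L_{i,j}\,z_{i,j}\,(e_i-e_j)(e_i-e_j)^\top,\qquad z_{i,j}=\sigma'(\theta^\star_i-\theta^\star_j),$$ where $e_i$ are the standard basis vectors. Let $L_z^\dagger$ be the pseudo-inverse of the symmetric matrix $L_z$, and put $$\Omega_{k,\ell}=(e_k-e_\ell)^\top L_z^\dagger(e_k-e_\ell),\qquad V_{k,\ell}=\sum_{(i,j)\in E,\ i<j}L_{i,j}\,\bigl|(e_i-e_j)^\top L_z^\dagger(e_k-e_\ell)\bigr|.$$ Let $\kappa_E\ge 1$ be such that $|\theta^\star_i-\theta^\star_j|\le\log\kappa_E$ for all $(i,j)\in E$. There is a universal constant $C>0$ such that the following holds for all such $L$, $\theta^\star$, $\kappa_E$. (1) Let $1\le r\le n$ and let $G$ be the 1D grid $\mathsf{Grid1D}(n,r,1)$: the nodes are $1,\dots,n$, and distinct $i,j$ are joined if and only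 if $|i-j|\le r$. Then for all $k\ne \ell$, $$\Omega_{k,\ell}\le C\begin{cases}\frac1r\cdot\frac{\kappa_E}{L}, & (k,\ell)\in E,\\[2pt] \frac1r\cdot\frac{\kappa_E}{L}\bigl(\frac{n}{r^2}+1\bigr), & (k,\ell)\notin E,\end{cases}\qquad V_{k,\ell}\le C\begin{cases}\kappa_E^{3/2}\sqrt n, & (k,\ell)\in E,\\[2pt] \kappa_E^{3/2}\sqrt n\,\sqrt{\frac{n}{r^2}+1}, & (k,\ell)\notin E.\end{cases}$$ (2) Let $n$ be a perfect square, $1\le r\le 2\sqrt n$, and let $G$ be the 2D grid $\mathsf{Grid2D}(n,r,1)$: the nodes are the pairs $(i_1,i_2)$ of integers with $1\le i_1,i_2\le\sqrt n$, and distinct $i,j$ are joined if and only if $|i_1-j_1|+|i_2-j_2|\le r$. Then for all $k\ne \ell$, $$\Omega_{k,\ell}\le C\begin{cases}\frac1{r^2}\cdot\frac{\kappa_E}{L}, & (k,\ell)\in E,\\[2pt] \frac1{r^2}\cdot\frac{\kappa_E}{L}\bigl(\frac{\log n}{r^2}+1\bigr), & (k,\ell)\notin E,\end{cases}\qquad V_{k,\ell}\le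 C\begin{cases}\kappa_E^{3/2}\sqrt n, & (k,\ell)\in E,\\[2pt] \kappa_E^{3/2}\sqrt n\,\sqrt{\frac{\log n}{r^2}+1}, & (k,\ell)\notin E.\end{cases}$$ -/

import Mathlib

namespace BTL

/-- The one-dimensional grid of radius `r` with edge probability one: the nodes are
`1, …, n` (indexed by `Fin n`) and two distinct nodes are joined iff `|i - j| ≤ r`. -/
def grid1D (n : ℕ) (r : ℝ) : SimpleGraph (Fin n) where
  Adj i j := i ≠ j ∧ |((i : ℕ) : ℝ) - ((j : ℕ) : ℝ)| ≤ r
  symm := ⟨fun _ _ h => ⟨h.1.symm, by rw [abs_sub_comm]; exact h.2⟩⟩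
  loopless := ⟨fun _ h => h.1 rfl⟩

/-- The two-dimensional grid of radius `r` with edge probability one on `n = m ^ 2` nodes:
the nodes are the pairs `(i₁, i₂)` with `i₁, i₂` in `1, …, m` (indexed by `Fin m`), and two
distinct nodes are joined iff `|i₁ - j₁| + |i₂ - j₂| ≤ r`. The lexicographic order on the
nodes only serves to list every edge once. -/
def grid2D (m : ℕ) (r : ℝ) : SimpleGraph (Fin m ×ₗ Fin m) where
  Adj i j := i ≠ j ∧
    |(((ofLex i).1 : ℕ) : ℝ) - (((ofLex j).1 : ℕ) : ℝ)| +
      |(((ofLex i).2 : ℕ) : ℝ) - (((ofLex j).2 : ℕ) : ℝ)| ≤ r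
  symm := ⟨fun i j h => ⟨h.1.symm, by
    rw [abs_sub_comm (((ofLex j).1 : ℕ) : ℝ), abs_sub_comm (((ofLex j).2 : ℕ) : ℝ)]
    exact h.2⟩⟩
  loopless := ⟨fun _ h => h.1 rfl⟩

section

variable {V : Type*} [Fintype V] [LinearOrder V]

open Classical in
/-- The edges `(i, j) ∈ E` with `i < j`. -/
noncomputable def edges (G : SimpleGraph V) : Finset (V × V) :=
  Finset.univ.filter fun p => p.1 < p.2 ∧ G.Adj p.1 p.2

/-- The vector `e_i - e_j`. -/
def ediff (i j : V) : V → ℝ := Pi.single i 1 - Pi.single j 1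

/-- The weight `z_{i,j} = σ'(θ_i - θ_j)`, where `σ` is the sigmoid function. -/
noncomputable def z (θ : V → ℝ) (i j : V) : ℝ := deriv Real.sigmoid (θ i - θ j)

/-- The graph Laplacian
`L_z = ∑_{(i,j) ∈ E, i < j} L_{i,j} z_{i,j} (e_i - e_j) (e_i - e_j)ᵀ`, where `N i j` is the
number `L_{i,j}` of samples on the edge `(i, j)` and `θ` is the vector of true scores. -/
noncomputable def laplacian (G : SimpleGraph V) (N : V → V → ℕ) (θ : V → ℝ) : Matrix V V ℝ :=
  ∑ p ∈ edges G, ((N p.1 p.2 : ℝ) * z θ p.1 p.2) •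
    Matrix.vecMulVec (ediff p.1 p.2) (ediff p.1 p.2)

theorem laplacian_isHermitian (G : SimpleGraph V) (N : V → V → ℕ) (θ : V → ℝ) :
    (laplacian G N θ).IsHermitian := by
  unfold Matrix.IsHermitian laplacian
  rw [Matrix.conjTranspose_sum]
  refine Finset.sum_congr rfl fun p _ => ?_
  rw [Matrix.conjTranspose_smul]
  congr 1
  ext i j
  simp [Matrix.vecMulVec_apply, mul_comm]

/-- The pseudo-inverse `U Λ⁻¹ Uᵀ` of a real symmetric matrix with eigendecomposition
`U Λ Uᵀ`: nonzero eigenvalues are inverted, and `0⁻¹ = 0` discards the kernel, which amounts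
to taking the compact eigendecomposition. -/
noncomputable def pinv {M : Matrix V V ℝ} (hM : M.IsHermitian) : Matrix V V ℝ :=
  (hM.eigenvectorUnitary : Matrix V V ℝ) * Matrix.diagonal (fun i => (hM.eigenvalues i)⁻¹) *
    (hM.eigenvectorUnitary : Matrix V V ℝ).transpose

/-- The pseudo-inverse of `L_z`. -/
noncomputable def laplacianPinv (G : SimpleGraph V) (N : V → V → ℕ) (θ : V → ℝ) :
    Matrix V V ℝ :=
  pinv (laplacian_isHermitian G N θ)

/-- The effective resistance `Ω_{k,l} = (e_k - e_l)ᵀ L_z^† (e_k - e_l)`. -/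
noncomputable def effRes (G : SimpleGraph V) (N : V → V → ℕ) (θ : V → ℝ) (k l : V) : ℝ :=
  ediff k l ⬝ᵥ (laplacianPinv G N θ).mulVec (ediff k l)

/-- The quantity `V_{k,l} = ∑_{(i,j) ∈ E, i < j} L_{i,j} |(e_i - e_j)ᵀ L_z^† (e_k - e_l)|`. -/
noncomputable def aggVolt (G : SimpleGraph V) (N : V → V → ℕ) (θ : V → ℝ) (k l : V) : ℝ :=
  ∑ p ∈ edges G, (N p.1 p.2 : ℝ) *
    |ediff p.1 p.2 ⬝ᵥ (laplacianPinv G N θ).mulVec (ediff k l)|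

end

end BTL

/-! Put `v = L_z^† (e_k - e_l)`. Since `L_z^† L_z L_z^† = L_z^†`, the resistance is both the
potential drop `v k - v l` and the weighted Dirichlet energy of `v`. On edges `σ' ≥ 1 / (4κ)`, so
the unweighted energy is at most `(4κ/L) Ω`. A Poincaré inequality `(v k - v l)² ≤ A · energy` then
reads `Ω² ≤ A (4κ/L) Ω`, and one factor `Ω` cancels. Cauchy–Schwarz over the edges bounds `V` by the
edge count and the same energy. Only edge counts and Poincaré constants remain
(`effRes_le_and_aggVolt_le`).

For these constants the grid is cut into blocks of side `s` comparable to `r`, small enough that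
neighbouring blocks are completely joined and each node is joined to, or lies in, every place of its
nearest block. Averaging `v` over blocks costs `O(1/|T|)` at each endpoint, with `|T|` the block
size, and the block averages have nearest-neighbour energy `O(1/|T|²)` times that of `v`. What is
left is the resistance of a path (its length) in dimension one, and of a `p × p` grid in dimension
two.

The grid resistance is `O(1 + log p)` (`gridEnergy_log`): from a point, average over segments of
growing length in a wedge. Layer `h` offers about `h` parallel edges, so it costs `O(1/h)`, and the
harmonic sum gives the logarithm. Comparing the last segment with the average over the whole grid
costs only a constant. -/

namespace BTL

/-! ### Reduction to edge counts and Poincaré inequalities -/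

section Reduction

variable {V : Type*} [Fintype V] [LinearOrder V]

/-- In the eigenbasis this is `x⁻¹ * x * x⁻¹ = x⁻¹`, true also at `x = 0`. It replaces any
description of the kernel of `L_z`, so connectivity of the graph plays no role. -/
theorem pinv_mul_self_mul_pinv {M : Matrix V V ℝ} (hM : M.IsHermitian) :
    pinv hM * M * pinv hM = pinv hM := by
  set U : Matrix V V ℝ := (hM.eigenvectorUnitary : Matrix V V ℝ) with hU
  have h1 : U.transpose * U = 1 := by
    have := Unitary.coe_star_mul_self hM.eigenvectorUnitary
    rwa [Matrix.star_eq_conjTranspose, Matrix.conjTranspose_eq_transpose_of_trivial] at this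
  have h2 : M = U * Matrix.diagonal hM.eigenvalues * U.transpose := by
    have := hM.spectral_theorem
    rw [Unitary.conjStarAlgAut_apply, Matrix.star_eq_conjTranspose,
      Matrix.conjTranspose_eq_transpose_of_trivial] at this
    exact this
  have hp : pinv hM = U * Matrix.diagonal (fun i => (hM.eigenvalues i)⁻¹) * U.transpose := rfl
  have hd : Matrix.diagonal (fun i => (hM.eigenvalues i)⁻¹) * Matrix.diagonal hM.eigenvalues *
      Matrix.diagonal (fun i => (hM.eigenvalues i)⁻¹) =
        Matrix.diagonal (fun i => (hM.eigenvalues i)⁻¹) := by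
    rw [Matrix.diagonal_mul_diagonal, Matrix.diagonal_mul_diagonal]
    congr 1
    ext i
    rcases eq_or_ne (hM.eigenvalues i) 0 with h | h
    · simp [h]
    · field_simp
  generalize pinv hM = P at *
  generalize hM.eigenvalues = ev at *
  generalize Matrix.diagonal (fun i => (ev i)⁻¹) = D at *
  generalize Matrix.diagonal ev = D' at *
  clear_value U
  subst hp
  calc U * D * U.transpose * M * (U * D * U.transpose)
      = U * (D * (U.transpose * U) * D' * (U.transpose * U) * D) * U.transpose := by
        rw [h2]; simp only [Matrix.mul_assoc]
    _ = _ := by rw [h1, Matrix.mul_one, Matrix.mul_one, hd]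

theorem pinv_transpose {M : Matrix V V ℝ} (hM : M.IsHermitian) :
    (pinv hM).transpose = pinv hM := by
  simp [pinv, Matrix.transpose_mul, Matrix.mul_assoc]

theorem ediff_dotProduct (i j : V) (v : V → ℝ) : ediff i j ⬝ᵥ v = v i - v j := by
  simp [ediff, sub_dotProduct]

theorem mem_edges {G : SimpleGraph V} {p : V × V} :
    p ∈ edges G ↔ p.1 < p.2 ∧ G.Adj p.1 p.2 := by
  simp [edges]

/-- The Dirichlet energy of `v` on the edges of `G`. -/
noncomputable def energy (G : SimpleGraph V) (v : V → ℝ) : ℝ :=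
  ∑ p ∈ edges G, (v p.1 - v p.2) ^ 2

theorem energy_nonneg (G : SimpleGraph V) (v : V → ℝ) : 0 ≤ energy G v :=
  Finset.sum_nonneg fun _ _ => sq_nonneg _

theorem dotProduct_laplacian_mulVec (G : SimpleGraph V) (N : V → V → ℕ) (θ v : V → ℝ) :
    v ⬝ᵥ (laplacian G N θ).mulVec v =
      ∑ p ∈ edges G, ((N p.1 p.2 : ℝ) * z θ p.1 p.2) * (v p.1 - v p.2) ^ 2 := by
  unfold laplacian
  rw [Matrix.sum_mulVec, dotProduct_sum]
  refine Finset.sum_congr rfl fun p _ => ?_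
  rw [Matrix.smul_mulVec, dotProduct_smul, Matrix.vecMulVec_mulVec, ediff_dotProduct]
  rw [dotProduct_comm]
  simp only [op_smul_eq_smul, smul_dotProduct, ediff_dotProduct, smul_eq_mul]
  ring

/-- The potential `L_z^† (e_k - e_l)`. -/
noncomputable def potential (G : SimpleGraph V) (N : V → V → ℕ) (θ : V → ℝ) (k l : V) : V → ℝ :=
  (laplacianPinv G N θ).mulVec (ediff k l)

theorem effRes_eq_sub (G : SimpleGraph V) (N : V → V → ℕ) (θ : V → ℝ) (k l : V) :
    effRes G N θ k l = potential G N θ k l k - potential G N θ k l l :=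
  ediff_dotProduct _ _ _

theorem effRes_eq_sum (G : SimpleGraph V) (N : V → V → ℕ) (θ : V → ℝ) (k l : V) :
    effRes G N θ k l = ∑ p ∈ edges G, ((N p.1 p.2 : ℝ) * z θ p.1 p.2) *
      (potential G N θ k l p.1 - potential G N θ k l p.2) ^ 2 := by
  rw [← dotProduct_laplacian_mulVec, effRes, potential]
  have h := pinv_mul_self_mul_pinv (laplacian_isHermitian G N θ)
  have ht := pinv_transpose (laplacian_isHermitian G N θ)
  change _ = laplacianPinv G N θ at h
  change _ = laplacianPinv G N θ at ht
  change laplacianPinv G N θ * _ * laplacianPinv G N θ = _ at h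
  change (laplacianPinv G N θ).transpose = _ at ht
  conv_lhs => rw [← h]
  rw [← Matrix.mulVec_mulVec, ← Matrix.mulVec_mulVec, Matrix.dotProduct_mulVec,
    ← Matrix.mulVec_transpose, ht]

/-- With `y = exp (-x)` the derivative is `y / (1 + y)²`, and `(1 + y)² ≤ 4κy` termwise from `1 ≤
κy`, `y ≤ κ` and `1 ≤ κ`. -/
theorem inv_four_mul_le_deriv_sigmoid {κ x : ℝ} (hκ : 1 ≤ κ) (hx : |x| ≤ Real.log κ) :
    1 / (4 * κ) ≤ deriv Real.sigmoid x := by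
  have hκ0 : 0 < κ := by linarith
  rw [Real.deriv_sigmoid]
  have h1 : Real.exp (-x) ≤ κ :=
    (Real.le_log_iff_exp_le hκ0).1 ((neg_le_abs x).trans hx)
  have h2 : Real.exp x ≤ κ :=
    (Real.le_log_iff_exp_le hκ0).1 ((le_abs_self x).trans hx)
  have h3 : Real.exp x * Real.exp (-x) = 1 := by rw [← Real.exp_add]; simp
  have h4 := Real.exp_pos (-x)
  have h5 : Real.sigmoid x * (1 - Real.sigmoid x) =
      Real.exp (-x) / (1 + Real.exp (-x)) ^ 2 := by
    rw [Real.sigmoid_def]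
    field_simp
    ring
  simp only [h5]
  rw [div_le_div_iff₀ (by positivity) (by positivity)]
  generalize Real.exp (-x) = y at *
  generalize Real.exp x = w at *
  have hy : 1 ≤ κ * y := by
    calc 1 = w * y := h3.symm
      _ ≤ κ * y := by gcongr
  nlinarith [mul_le_mul_of_nonneg_left h1 h4.le, mul_le_mul_of_nonneg_left hκ h4.le]

/-- A Poincaré type inequality for the pair `k, l` and a bound on the number of edges bound both
the effective resistance and the aggregated voltage. -/
theorem effRes_le_and_aggVolt_le (G : SimpleGraph V) (L : ℕ) (κ : ℝ) (θ : V → ℝ) (k l : V)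
    (hL : 1 ≤ L) (hκ : 1 ≤ κ) (hθ : ∀ i j, G.Adj i j → |θ i - θ j| ≤ Real.log κ)
    {c ρ X n : ℝ} (hc : 0 ≤ c) (hρ : 0 < ρ) (hX : 0 ≤ X) (hn : 0 ≤ n)
    (hcard : ((edges G).card : ℝ) ≤ c * (n * ρ))
    (hP : ∀ v : V → ℝ, (v k - v l) ^ 2 ≤ c * (1 / ρ * X) * energy G v) :
    effRes G (fun _ _ => L) θ k l ≤ 4 * c * (1 / ρ * (κ / L) * X) ∧
      aggVolt G (fun _ _ => L) θ k l ≤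
        4 * c * (κ ^ (3 / 2 : ℝ) * Real.sqrt n * Real.sqrt X) := by
  have hL' : (1 : ℝ) ≤ L := by exact_mod_cast hL
  set Ω := effRes G (fun _ _ => L) θ k l with hΩ
  set v := potential G (fun _ _ => L) θ k l with hv
  set A := c * (1 / ρ * X) with hA
  have hA0 : 0 ≤ A := by positivity
  have hE : energy G v ≤ 4 * κ / L * Ω := by
    rw [hΩ, effRes_eq_sum, energy, Finset.mul_sum]
    refine Finset.sum_le_sum fun p hp => ?_
    rw [← mul_assoc]
    refine le_mul_of_one_le_left (sq_nonneg _) ?_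
    have hadj : G.Adj p.1 p.2 := (mem_edges.1 hp).2
    have hz : 1 / (4 * κ) ≤ z θ p.1 p.2 := inv_four_mul_le_deriv_sigmoid hκ (hθ _ _ hadj)
    rw [div_le_iff₀ (by positivity)] at hz
    have : 4 * κ / L * (L * z θ p.1 p.2) = z θ p.1 p.2 * (4 * κ) := by field_simp
    rw [this]
    exact hz
  have hE0 := energy_nonneg G v
  have hΩ0 : 0 ≤ Ω := by
    have : 0 < 4 * κ / (L : ℝ) := by positivity
    by_contra hneg
    push Not at hneg
    nlinarith
  have hsq : Ω ^ 2 ≤ A * (4 * κ / L) * Ω := by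
    calc Ω ^ 2 = (v k - v l) ^ 2 := by rw [hΩ, effRes_eq_sub]
      _ ≤ A * energy G v := hP v
      _ ≤ A * (4 * κ / L * Ω) := by gcongr
      _ = _ := by ring
  have hΩA : Ω ≤ A * (4 * κ / L) := by
    rcases hΩ0.eq_or_lt with h | h
    · rw [← h]; positivity
    · rw [pow_two] at hsq
      exact le_of_mul_le_mul_right hsq h
  refine ⟨hΩA.trans (le_of_eq (by rw [hA]; ring)), ?_⟩
  have hV : aggVolt G (fun _ _ => L) θ k l = ∑ p ∈ edges G, (L : ℝ) * |v p.1 - v p.2| := by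
    unfold aggVolt
    refine Finset.sum_congr rfl fun p _ => ?_
    rw [ediff_dotProduct]
    rfl
  -- Cauchy–Schwarz; the `ρ` of the edge count cancels the `1 / ρ` in `A`, and `L` cancels as well.
  have hV2 : (∑ p ∈ edges G, (L : ℝ) * |v p.1 - v p.2|) ^ 2 ≤ (4 * c * κ) ^ 2 * (n * X) := by
    rw [← Finset.mul_sum, mul_pow]
    calc (L : ℝ) ^ 2 * (∑ p ∈ edges G, |v p.1 - v p.2|) ^ 2
        ≤ (L : ℝ) ^ 2 * ((edges G).card * ∑ p ∈ edges G, |v p.1 - v p.2| ^ 2) := by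
          gcongr; exact sq_sum_le_card_mul_sum_sq
      _ = (L : ℝ) ^ 2 * ((edges G).card * energy G v) := by simp only [sq_abs, energy]
      _ ≤ (L : ℝ) ^ 2 * (c * (n * ρ) * (4 * κ / L * (A * (4 * κ / L)))) := by
          gcongr
          exact hE.trans (by gcongr)
      _ = _ := by rw [hA]; field_simp
  -- The argument gives the first power of `κ`; it is weakened here to the exponent `3 / 2`.
  have hκ' : κ ≤ κ ^ (3 / 2 : ℝ) := by
    conv_lhs => rw [← Real.rpow_one κ]
    exact Real.rpow_le_rpow_of_exponent_le hκ (by norm_num)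
  rw [hV]
  calc _ ≤ Real.sqrt ((4 * c * κ) ^ 2 * (n * X)) := Real.le_sqrt_of_sq_le hV2
    _ = 4 * c * (κ * Real.sqrt n * Real.sqrt X) := by
        rw [Real.sqrt_mul (by positivity), Real.sqrt_sq (by positivity), Real.sqrt_mul hn]; ring
    _ ≤ _ := by gcongr

end Reduction

/-! ### Logarithmic resistance of the nearest-neighbour grid -/

section Grid

open Finset

/-- The Dirichlet energy of `u` on the `p × p` nearest neighbour grid. -/
noncomputable def gridEnergy (p : ℕ) (u : ℕ → ℕ → ℝ) : ℝ :=
  ∑ i ∈ range (p - 1), ∑ j ∈ range p, (u i j - u (i + 1) j) ^ 2 +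
    ∑ i ∈ range p, ∑ j ∈ range (p - 1), (u i j - u i (j + 1)) ^ 2

theorem gridEnergy_nonneg (p : ℕ) (u : ℕ → ℕ → ℝ) : 0 ≤ gridEnergy p u := by
  unfold gridEnergy; positivity

theorem abs_sub_le_sum_abs_Ico (f : ℕ → ℝ) {a b : ℕ} (h : a ≤ b) :
    |f a - f b| ≤ ∑ i ∈ Ico a b, |f i - f (i + 1)| := by
  simpa [Real.dist_eq] using dist_le_Ico_sum_dist f h

theorem abs_sub_le_sum_abs (f : ℕ → ℝ) {a b p : ℕ} (ha : a < p) (hb : b < p) :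
    |f a - f b| ≤ ∑ i ∈ range (p - 1), |f i - f (i + 1)| := by
  wlog h : a ≤ b generalizing a b
  · rw [abs_sub_comm]; exact this hb ha (by omega)
  refine (abs_sub_le_sum_abs_Ico f h).trans
    (sum_le_sum_of_subset_of_nonneg (fun i hi => ?_) fun _ _ _ => abs_nonneg _)
  simp at hi ⊢; omega

theorem sq_sub_le_sum_sq (f : ℕ → ℝ) {a b p : ℕ} (ha : a < p) (hb : b < p) :
    (f a - f b) ^ 2 ≤ |(a : ℝ) - b| * ∑ i ∈ range (p - 1), (f i - f (i + 1)) ^ 2 := by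
  wlog h : a ≤ b generalizing a b
  · rw [abs_sub_comm, sub_sq_comm]; exact this hb ha (by omega)
  have h1 : |(a : ℝ) - b| = ((Ico a b).card : ℝ) := by
    rw [abs_sub_comm, abs_of_nonneg (by simpa using h), Nat.card_Ico, Nat.cast_sub h]
  rw [h1, ← sq_abs]
  calc |f a - f b| ^ 2 ≤ (∑ i ∈ Ico a b, |f i - f (i + 1)|) ^ 2 := by
        gcongr; exact abs_sub_le_sum_abs_Ico f h
    _ ≤ _ := sq_sum_le_card_mul_sum_sq
    _ ≤ _ := by
        simp only [sq_abs]
        gcongr with i hi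
        intro i hi
        simp at hi ⊢; omega

/-- An L-shaped path joins the two points. This serves endpoints at bounded distance, where the
logarithmic bound would be too weak. -/
theorem gridEnergy_path {p : ℕ} (u : ℕ → ℕ → ℝ) {a b a' b' : ℕ} (ha : a < p) (hb : b < p)
    (ha' : a' < p) (hb' : b' < p) :
    (u a b - u a' b') ^ 2 ≤ 2 * (|(a : ℝ) - a'| + |(b : ℝ) - b'|) * gridEnergy p u := by
  have h1 : (u a b - u a' b) ^ 2 ≤ |(a : ℝ) - a'| * gridEnergy p u := by
    refine (sq_sub_le_sum_sq (fun i => u i b) ha ha').trans ?_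
    gcongr
    unfold gridEnergy
    rw [sum_comm]
    refine le_add_of_le_of_nonneg ?_ (by positivity)
    exact single_le_sum (f := fun j => ∑ i ∈ range (p - 1), (u i j - u (i + 1) j) ^ 2)
      (fun _ _ => by positivity) (mem_range.2 hb)
  have h2 : (u a' b - u a' b') ^ 2 ≤ |(b : ℝ) - b'| * gridEnergy p u := by
    refine (sq_sub_le_sum_sq (fun j => u a' j) hb hb').trans ?_
    gcongr
    unfold gridEnergy
    refine le_add_of_nonneg_of_le (by positivity) ?_
    exact single_le_sum (f := fun i => ∑ j ∈ range (p - 1), (u i j - u i (j + 1)) ^ 2)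
      (fun _ _ => by positivity) (mem_range.2 ha')
  nlinarith [sq_nonneg ((u a b - u a' b) - (u a' b - u a' b'))]

/-- The average of `w h` over `0, …, h`. -/
noncomputable def wedgeAvg (w : ℕ → ℕ → ℝ) (h : ℕ) : ℝ :=
  (∑ j ∈ range (h + 1), w h j) / (h + 1)

theorem abs_wedgeAvg_sub_le (w : ℕ → ℕ → ℝ) (h : ℕ) :
    |wedgeAvg w h - wedgeAvg w (h + 1)| ≤ (∑ j ∈ range (h + 1), |w h j - w (h + 1) j| +
      ∑ j ∈ range (h + 1), |w (h + 1) j - w (h + 1) (j + 1)|) / (h + 1) := by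
  set T := ∑ j ∈ range (h + 1), |w (h + 1) j - w (h + 1) (j + 1)| with hT
  have hT0 : 0 ≤ T := by positivity
  have h0 : (0 : ℝ) < h + 1 := by positivity
  -- Row `h + 1` has one entry more than row `h`. The second sum is the cost of passing from the
  -- average of its first `h + 1` entries to its full average.
  have e : wedgeAvg w h - wedgeAvg w (h + 1) =
      ((∑ j ∈ range (h + 1), (w h j - w (h + 1) j)) +
        (∑ j ∈ range (h + 1), (w (h + 1) j - w (h + 1) (h + 1))) / (h + 2)) / (h + 1) := by
    unfold wedgeAvg
    rw [sum_range_succ _ (h + 1), sum_sub_distrib, sum_sub_distrib]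
    simp only [sum_const, card_range, nsmul_eq_mul]
    push_cast
    field_simp
    ring
  rw [e, abs_div, abs_of_pos h0]
  gcongr
  refine (abs_add_le _ _).trans (add_le_add (abs_sum_le_sum_abs _ _) ?_)
  rw [abs_div, abs_of_pos (by positivity : (0 : ℝ) < h + 2), div_le_iff₀ (by positivity)]
  calc |∑ j ∈ range (h + 1), (w (h + 1) j - w (h + 1) (h + 1))|
      ≤ ∑ j ∈ range (h + 1), |w (h + 1) j - w (h + 1) (h + 1)| := abs_sum_le_sum_abs _ _
    _ ≤ ∑ j ∈ range (h + 1), T := by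
        refine sum_le_sum fun j hj => ?_
        exact abs_sub_le_sum_abs (w (h + 1)) (p := h + 2) (by simp at hj; omega) (by omega)
    _ ≤ T * (h + 2) := by simp; nlinarith

/-- Cauchy–Schwarz over the `h + 1` parallel edges of a layer turns the weight `1 / (h + 1)` into a
resistance of order `1 / (h + 1)`. -/
theorem sq_wedgeAvg_sub_le (w : ℕ → ℕ → ℝ) (h : ℕ) :
    (wedgeAvg w h - wedgeAvg w (h + 1)) ^ 2 ≤ (2 * (h + 1 : ℝ)⁻¹) *
      (∑ j ∈ range (h + 1), (w h j - w (h + 1) j) ^ 2 +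
      ∑ j ∈ range (h + 1), (w (h + 1) j - w (h + 1) (j + 1)) ^ 2) := by
  have h0 : (0 : ℝ) < h + 1 := by positivity
  have key : ∀ f : ℕ → ℝ, (∑ j ∈ range (h + 1), |f j|) ^ 2 ≤
      (h + 1) * ∑ j ∈ range (h + 1), f j ^ 2 := fun f => by
    simpa using sq_sum_le_card_mul_sum_sq (s := range (h + 1)) (f := fun j => |f j|)
  have k1 := key fun j => w h j - w (h + 1) j
  have k2 := key fun j => w (h + 1) j - w (h + 1) (j + 1)
  have k3 := abs_wedgeAvg_sub_le w h
  set S := ∑ j ∈ range (h + 1), |w h j - w (h + 1) j|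
  set T := ∑ j ∈ range (h + 1), |w (h + 1) j - w (h + 1) (j + 1)|
  set S2 := ∑ j ∈ range (h + 1), (w h j - w (h + 1) j) ^ 2
  set T2 := ∑ j ∈ range (h + 1), (w (h + 1) j - w (h + 1) (j + 1)) ^ 2
  rw [← sq_abs]
  calc _ ≤ ((S + T) / (h + 1)) ^ 2 := by gcongr
    _ = (S + T) ^ 2 / (h + 1) ^ 2 := by rw [div_pow]
    _ ≤ (2 * ((h + 1) * S2 + (h + 1) * T2)) / (h + 1) ^ 2 := by
        gcongr; nlinarith [sq_nonneg (S - T)]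
    _ = _ := by field_simp

theorem sum_inv_range_le (H : ℕ) : ∑ h ∈ range H, ((h : ℝ) + 1)⁻¹ ≤ 1 + Real.log H := by
  have := harmonic_le_one_add_log H
  simpa [harmonic] using this

/-- Telescoping over layers and weighted Cauchy–Schwarz leave the harmonic sum of the layer
resistances. -/
theorem sq_sub_wedgeAvg_le (w : ℕ → ℕ → ℝ) (H : ℕ) :
    (w 0 0 - wedgeAvg w H) ^ 2 ≤ 2 * (1 + Real.log H) *
      (∑ h ∈ range H, ∑ j ∈ range (H + 1), (w h j - w (h + 1) j) ^ 2 +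
      ∑ h ∈ range (H + 1), ∑ j ∈ range H, (w h j - w h (j + 1)) ^ 2) := by
  have h0 : w 0 0 = wedgeAvg w 0 := by simp [wedgeAvg]
  rw [h0, ← sum_range_sub']
  refine (sum_sq_le_sum_mul_sum_of_sq_le_mul (range H) (fun h _ => by positivity)
    (fun h _ => by positivity) (fun h _ => sq_wedgeAvg_sub_le w h)).trans ?_
  rw [← mul_sum]
  have h1 := sum_inv_range_le H
  -- Differences within a row occur only for rows `1, …, H`; row `0` is split off on the right and
  -- discarded.
  rw [sum_add_distrib, sum_range_succ' _ H]
  have : 0 ≤ ∑ h ∈ range H, ((h : ℝ) + 1)⁻¹ := by positivity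
  gcongr (2 * ?_) * (?_ + ?_)
  · refine sum_le_sum fun h hh => sum_le_sum_of_subset_of_nonneg ?_ fun _ _ _ => sq_nonneg _
    simp at hh ⊢; omega
  · refine le_add_of_le_of_nonneg ?_ (by positivity)
    refine sum_le_sum fun h hh => sum_le_sum_of_subset_of_nonneg ?_ fun _ _ _ => sq_nonneg _
    simp at hh ⊢; omega

/-- From every point of `0, …, p - 1` there is a monotone path inside of length at least half
of the interval. -/
theorem exists_ray {a p : ℕ} (ha : a < p) : ∃ τ : ℕ → ℕ, τ 0 = a ∧
    (∀ f : ℕ → ℝ, (∀ i, 0 ≤ f i) →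
      ∑ h ∈ range ((p - 1) / 2 + 1), f (τ h) ≤ ∑ i ∈ range p, f i) ∧
    (∀ g : ℕ → ℕ → ℝ, (∀ i j, 0 ≤ g i j) → (∀ i j, g i j = g j i) →
      ∑ h ∈ range ((p - 1) / 2), g (τ h) (τ (h + 1)) ≤ ∑ i ∈ range (p - 1), g i (i + 1)) ∧
    (∀ h ≤ (p - 1) / 2, τ h < p) := by
  obtain ⟨H, hH⟩ : ∃ H, H = (p - 1) / 2 := ⟨_, rfl⟩
  rw [← hH]
  -- Upwards there is room for `H` steps if `a ≤ H`; otherwise go downwards, where the symmetry of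
  -- `g` reverses the edges.
  by_cases h : a ≤ H
  · refine ⟨fun h => a + h, rfl, fun f hf => ?_, fun g hg _ => ?_, fun h _ => by dsimp only; omega⟩
    · rw [← sum_image (g := fun h => a + h) (f := f) (fun x _ y _ h => by simpa using h)]
      refine sum_le_sum_of_subset_of_nonneg ?_ fun _ _ _ => hf _
      intro i hi; simp at hi ⊢; omega
    · have : ∑ h ∈ range H, g (a + h) (a + (h + 1)) =
          ∑ i ∈ (range H).image (fun h => a + h), g i (i + 1) := by
        rw [sum_image (fun x _ y _ h => by simpa using h)]
        rfl
      rw [this]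
      refine sum_le_sum_of_subset_of_nonneg ?_ fun _ _ _ => hg _ _
      intro i hi; simp at hi ⊢; omega
  · refine ⟨fun h => a - h, rfl, fun f hf => ?_, fun g hg hs => ?_, fun h _ => by dsimp only; omega⟩
    · rw [← sum_image (g := fun h => a - h) (f := f)
        (fun x hx y hy h => by simp at hx hy h; omega)]
      refine sum_le_sum_of_subset_of_nonneg ?_ fun _ _ _ => hf _
      intro i hi; simp at hi ⊢; omega
    · have : ∑ h ∈ range H, g (a - h) (a - (h + 1)) =
          ∑ i ∈ (range H).image (fun h => a - (h + 1)), g i (i + 1) := by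
        rw [sum_image (fun x hx y hy h => by simp at hx hy h; omega)]
        refine sum_congr rfl fun i hi => ?_
        rw [hs]
        congr 1
        simp at hi; omega
      rw [this]
      refine sum_le_sum_of_subset_of_nonneg ?_ fun _ _ _ => hg _ _
      intro i hi; simp at hi ⊢; omega

theorem sq_sum_sum_abs_le (s t : Finset ℕ) (f : ℕ → ℕ → ℝ) :
    (∑ i ∈ s, ∑ j ∈ t, |f i j|) ^ 2 ≤ (#s * #t) * ∑ i ∈ s, ∑ j ∈ t, f i j ^ 2 := by
  have := sq_sum_le_card_mul_sum_sq (s := s ×ˢ t) (f := fun x => |f x.1 x.2|)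
  simpa [sum_product] using this

theorem sum_sum_abs_col_le (p : ℕ) (u : ℕ → ℕ → ℝ) :
    ∑ j ∈ range p, ∑ i ∈ range (p - 1), |u i j - u (i + 1) j| ≤ p * √(gridEnergy p u) := by
  have h := sq_sum_sum_abs_le (range p) (range (p - 1)) fun j i => u i j - u (i + 1) j
  have : (p : ℝ) * √(gridEnergy p u) = √((p * p) * gridEnergy p u) := by
    rw [Real.sqrt_mul (by positivity), Real.sqrt_mul_self (by positivity)]
  rw [this]
  refine Real.le_sqrt_of_sq_le (h.trans ?_)
  simp only [card_range]
  gcongr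
  · omega
  · rw [sum_comm, gridEnergy]
    exact le_add_of_nonneg_right (by positivity)

theorem sum_sum_abs_row_le (p : ℕ) (u : ℕ → ℕ → ℝ) :
    ∑ i ∈ range p, ∑ j ∈ range (p - 1), |u i j - u i (j + 1)| ≤ p * √(gridEnergy p u) := by
  have h := sq_sum_sum_abs_le (range p) (range (p - 1)) fun i j => u i j - u i (j + 1)
  have : (p : ℝ) * √(gridEnergy p u) = √((p * p) * gridEnergy p u) := by
    rw [Real.sqrt_mul (by positivity), Real.sqrt_mul_self (by positivity)]
  rw [this]
  refine Real.le_sqrt_of_sq_le (h.trans ?_)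
  simp only [card_range]
  gcongr
  · omega
  · rw [gridEnergy]
    exact le_add_of_nonneg_left (by positivity)

/-- If `x i` is within `c i` of `y j` for all `i, j` then the averages are within the average
of `c`. -/
theorem abs_avg_sub_avg_le {s t : Finset ℕ} (hs : 0 < #s) (ht : 0 < #t) (x y : ℕ → ℝ) {c : ℝ}
    (h : ∀ i ∈ s, ∀ j ∈ t, |x i - y j| ≤ c) :
    |(∑ i ∈ s, x i) / #s - (∑ j ∈ t, y j) / #t| ≤ c := by
  have hs' : (0 : ℝ) < #s := by exact_mod_cast hs
  have ht' : (0 : ℝ) < #t := by exact_mod_cast ht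
  have e : (∑ i ∈ s, x i) / #s - (∑ j ∈ t, y j) / #t =
      (∑ i ∈ s, ∑ j ∈ t, (x i - y j)) / (#s * #t) := by
    simp only [sum_sub_distrib, sum_const, nsmul_eq_mul, ← mul_sum]
    field_simp
  rw [e, abs_div, abs_of_pos (by positivity : (0 : ℝ) < #s * #t), div_le_iff₀ (by positivity)]
  calc _ ≤ ∑ i ∈ s, ∑ j ∈ t, |x i - y j| :=
        (abs_sum_le_sum_abs _ _).trans (sum_le_sum fun _ _ => abs_sum_le_sum_abs _ _)
    _ ≤ ∑ i ∈ s, ∑ j ∈ t, c := sum_le_sum fun i hi => sum_le_sum fun j hj => h i hi j hj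
    _ = _ := by simp; ring

/-- The value at a point of the grid differs from the average over the grid by
`O(√(log p))` times the square root of the energy. -/
theorem abs_sub_gridAvg_le {p : ℕ} (u : ℕ → ℕ → ℝ) {a b : ℕ} (ha : a < p) (hb : b < p) :
    |u a b - (∑ i ∈ range p, (∑ j ∈ range p, u i j) / p) / p| ≤
      √(2 * (1 + Real.log p) * gridEnergy p u) + 3 * √(gridEnergy p u) := by
  obtain ⟨τ, hτ0, hτ1, hτ2, hτ3⟩ := exists_ray ha
  obtain ⟨σ, hσ0, hσ1, hσ2, hσ3⟩ := exists_ray hb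
  obtain ⟨H, hH⟩ : ∃ H, H = (p - 1) / 2 := ⟨_, rfl⟩
  rw [← hH] at hτ1 hτ2 hτ3 hσ1 hσ2 hσ3
  have hp : 0 < p := by omega
  have hp' : (0 : ℝ) < p := by exact_mod_cast hp
  have hH1 : (0 : ℝ) < (H : ℝ) + 1 := by positivity
  set E := gridEnergy p u with hE
  have hE0 : 0 ≤ E := gridEnergy_nonneg p u
  set F := wedgeAvg (fun h j => u (τ h) (σ j)) H with hF
  -- From the point to the far side of the wedge spanned by the two rays: the only step that costs a
  -- logarithm.
  have s1 : |u a b - F| ≤ √(2 * (1 + Real.log p) * E) := by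
    refine Real.abs_le_sqrt ?_
    have h := sq_sub_wedgeAvg_le (fun h j => u (τ h) (σ j)) H
    simp only [hτ0, hσ0] at h
    refine h.trans ?_
    have hlog : Real.log H ≤ Real.log p := by
      rcases Nat.eq_zero_or_pos H with h0 | h0
      · rw [h0]; simp; exact Real.log_natCast_nonneg p
      · apply Real.log_le_log (by exact_mod_cast h0)
        have : H ≤ p := by omega
        exact_mod_cast this
    have := Real.log_natCast_nonneg p
    rw [hE, gridEnergy]
    gcongr (2 * (1 + ?_)) * (?_ + ?_)
    · calc _ = ∑ j ∈ range (H + 1), ∑ h ∈ range H, (u (τ h) (σ j) - u (τ (h + 1)) (σ j)) ^ 2 :=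
            sum_comm
        _ ≤ ∑ j ∈ range (H + 1), ∑ i ∈ range (p - 1), (u i (σ j) - u (i + 1) (σ j)) ^ 2 :=
            sum_le_sum fun j _ => hτ2 (fun i i' => (u i (σ j) - u i' (σ j)) ^ 2)
              (fun _ _ => sq_nonneg _) (fun _ _ => sub_sq_comm _ _)
        _ ≤ ∑ j ∈ range p, ∑ i ∈ range (p - 1), (u i j - u (i + 1) j) ^ 2 :=
            hσ1 (fun j => ∑ i ∈ range (p - 1), (u i j - u (i + 1) j) ^ 2)
              fun _ => by positivity
        _ = _ := sum_comm
    · calc _ ≤ ∑ h ∈ range (H + 1), ∑ j ∈ range (p - 1), (u (τ h) j - u (τ h) (j + 1)) ^ 2 :=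
            sum_le_sum fun h _ => hσ2 (fun j j' => (u (τ h) j - u (τ h) j') ^ 2)
              (fun _ _ => sq_nonneg _) (fun _ _ => sub_sq_comm _ _)
        _ ≤ _ := hτ1 (fun i => ∑ j ∈ range (p - 1), (u i j - u i (j + 1)) ^ 2)
              fun _ => by positivity
  -- Replace the single index `τ H` by the average over all first indices. The factor 2 is `p ≤ 2 *
  -- (H + 1)`.
  have s2 : |F - (∑ j ∈ range (H + 1), (∑ i ∈ range p, u i (σ j)) / p) / (H + 1)| ≤
      2 * √E := by
    have e : F - (∑ j ∈ range (H + 1), (∑ i ∈ range p, u i (σ j)) / p) / (H + 1) =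
        (∑ j ∈ range (H + 1), (u (τ H) (σ j) - (∑ i ∈ range p, u i (σ j)) / p)) / (H + 1) := by
      rw [hF, wedgeAvg, ← sub_div, ← sum_sub_distrib]
    rw [e, abs_div, abs_of_pos hH1, div_le_iff₀ hH1]
    calc _ ≤ ∑ j ∈ range (H + 1), |u (τ H) (σ j) - (∑ i ∈ range p, u i (σ j)) / p| :=
          abs_sum_le_sum_abs _ _
      _ ≤ ∑ j ∈ range (H + 1), ∑ i ∈ range (p - 1), |u i (σ j) - u (i + 1) (σ j)| := by
          refine sum_le_sum fun j _ => ?_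
          have := abs_avg_sub_avg_le (s := {0}) (t := range p) (by simp) (by simpa using hp)
            (fun _ => u (τ H) (σ j)) (fun i => u i (σ j))
            (c := ∑ i ∈ range (p - 1), |u i (σ j) - u (i + 1) (σ j)|)
            (fun _ _ i hi => abs_sub_le_sum_abs (fun i => u i (σ j)) (hτ3 H le_rfl)
              (mem_range.1 hi))
          simpa using this
      _ ≤ ∑ j ∈ range p, ∑ i ∈ range (p - 1), |u i j - u (i + 1) j| :=
          hσ1 (fun j => ∑ i ∈ range (p - 1), |u i j - u (i + 1) j|) fun _ => by positivity
      _ ≤ p * √E := sum_sum_abs_col_le p u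
      _ ≤ (2 * (H + 1)) * √E := by
          gcongr
          have : p ≤ 2 * (H + 1) := by omega
          exact_mod_cast this
      _ = _ := by ring
  -- Extend the average in the second index from the ray to the whole side.
  have s3 : |(∑ j ∈ range (H + 1), (∑ i ∈ range p, u i (σ j)) / p) / (H + 1) -
      (∑ i ∈ range p, (∑ j ∈ range p, u i j) / p) / p| ≤ √E := by
    have e : (∑ j ∈ range (H + 1), (∑ i ∈ range p, u i (σ j)) / p) / (H + 1) -
        (∑ i ∈ range p, (∑ j ∈ range p, u i j) / p) / p =
        (∑ i ∈ range p, ((∑ j ∈ range (H + 1), u i (σ j)) / (H + 1) -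
          (∑ j ∈ range p, u i j) / p)) / p := by
      rw [sum_sub_distrib, ← sum_div, ← sum_div, ← sum_div, sum_comm]
      ring
    rw [e, abs_div, abs_of_pos hp', div_le_iff₀ hp', mul_comm (√E)]
    refine (abs_sum_le_sum_abs _ _).trans (le_trans (sum_le_sum fun i _ => ?_)
      (sum_sum_abs_row_le p u))
    have := abs_avg_sub_avg_le (s := range (H + 1)) (t := range p) (by simp) (by simpa using hp)
      (fun j => u i (σ j)) (fun j => u i j)
      (c := ∑ j ∈ range (p - 1), |u i j - u i (j + 1)|)
      (fun h hh j hj => abs_sub_le_sum_abs (fun j => u i j)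
        (hσ3 h (by simp at hh; omega)) (mem_range.1 hj))
    simpa using this
  refine (abs_sub_le _ F _).trans (add_le_add s1 ((abs_sub_le _ _ _).trans
    ((add_le_add s2 s3).trans (le_of_eq (by ring)))))

/-- The effective resistance of the `p × p` grid is `O(1 + log p)`. -/
theorem gridEnergy_log {p : ℕ} (u : ℕ → ℕ → ℝ) {a b a' b' : ℕ} (ha : a < p) (hb : b < p)
    (ha' : a' < p) (hb' : b' < p) :
    (u a b - u a' b') ^ 2 ≤ 100 * (1 + Real.log p) * gridEnergy p u := by
  have h1 := abs_sub_gridAvg_le u ha hb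
  have h2 := abs_sub_gridAvg_le u ha' hb'
  rw [abs_sub_comm] at h2
  have h3 := abs_sub_le (u a b) ((∑ i ∈ range p, (∑ j ∈ range p, u i j) / p) / p) (u a' b')
  have hE := gridEnergy_nonneg p u
  have hl := Real.log_natCast_nonneg p
  set E := gridEnergy p u
  have h4 : √E ≤ √((1 + Real.log p) * E) := by
    apply Real.sqrt_le_sqrt; nlinarith
  have h5 : √(2 * (1 + Real.log p) * E) ≤ 2 * √((1 + Real.log p) * E) := by
    rw [mul_assoc, Real.sqrt_mul (by norm_num)]
    gcongr
    rw [Real.sqrt_le_left (by norm_num)]; norm_num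
  -- Each endpoint contributes `2 + 3`.
  have h6 : |u a b - u a' b'| ≤ 10 * √((1 + Real.log p) * E) := by linarith
  rw [← sq_abs]
  calc _ ≤ (10 * √((1 + Real.log p) * E)) ^ 2 := by gcongr
    _ = _ := by rw [mul_pow, Real.sq_sqrt (by positivity)]; ring

end Grid

/-! ### Coarse graining by block averages -/

section Coarse

variable {V : Type*} [Fintype V] [LinearOrder V]

/-- A sum of squared differences over distinct ordered pairs of adjacent (or equal) nodes is at
most twice the energy. -/
theorem sum_sq_sub_le_energy (G : SimpleGraph V) (v : V → ℝ) {ι : Type*} (F : Finset ι)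
    (x y : ι → V) (hinj : ∀ e ∈ F, ∀ e' ∈ F, x e = x e' → y e = y e' → e = e')
    (hadj : ∀ e ∈ F, x e = y e ∨ G.Adj (x e) (y e)) :
    ∑ e ∈ F, (v (x e) - v (y e)) ^ 2 ≤ 2 * energy G v := by
  classical
  -- Increasing and decreasing pairs each embed into the edge list, whence the factor 2; equal pairs
  -- contribute zero.
  have key : ∀ x y : ι → V, (∀ e ∈ F, ∀ e' ∈ F, x e = x e' → y e = y e' → e = e') →
      (∀ e ∈ F, x e = y e ∨ G.Adj (x e) (y e)) →
      ∑ e ∈ F.filter (fun e => x e < y e), (v (x e) - v (y e)) ^ 2 ≤ energy G v := by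
    intro x y hinj hadj
    have hi : Set.InjOn (fun e => (x e, y e)) (F.filter fun e => x e < y e) := by
      intro e he e' he' h
      simp at he he' h
      exact hinj e he.1 e' he'.1 h.1 h.2
    rw [← Finset.sum_image (g := fun e => (x e, y e)) (f := fun p => (v p.1 - v p.2) ^ 2) hi]
    refine Finset.sum_le_sum_of_subset_of_nonneg (fun p hp => ?_) fun _ _ _ => sq_nonneg _
    simp only [Finset.mem_image, Finset.mem_filter] at hp
    obtain ⟨e, ⟨he, hlt⟩, rfl⟩ := hp
    exact mem_edges.2 ⟨hlt, (hadj e he).resolve_left hlt.ne⟩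
  have h1 := key x y hinj hadj
  have h2 := key y x (fun e he e' he' h h' => hinj e he e' he' h' h)
    fun e he => (hadj e he).imp Eq.symm fun h => h.symm
  have h3 : ∑ e ∈ F, (v (x e) - v (y e)) ^ 2 =
      ∑ e ∈ F.filter (fun e => x e < y e), (v (x e) - v (y e)) ^ 2 +
      ∑ e ∈ F.filter (fun e => y e < x e), (v (y e) - v (x e)) ^ 2 := by
    rw [Finset.sum_filter, Finset.sum_filter, ← Finset.sum_add_distrib]
    refine Finset.sum_congr rfl fun e _ => ?_
    rcases lt_trichotomy (x e) (y e) with h | h | h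
    · simp [h, h.not_gt]
    · simp [h]
    · simp [h, h.not_gt, sub_sq_comm]
  linarith

variable {P T : Type*} [Fintype T] [Nonempty T]

/-- The average of `v` over the block `a`. -/
noncomputable def blockAvg (φ : P → T → V) (v : V → ℝ) (a : P) : ℝ :=
  (∑ t, v (φ a t)) / Fintype.card T

/-- The edges from `k` to the block act as parallel resistors: Cauchy–Schwarz gains a factor `1 /
|T|`. -/
theorem sq_sub_blockAvg_le (G : SimpleGraph V) (v : V → ℝ) (φ : P → T → V) (k : V) (a : P)
    (hinj : Function.Injective (φ a)) (hadj : ∀ t, k = φ a t ∨ G.Adj k (φ a t)) :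
    (v k - blockAvg φ v a) ^ 2 ≤ 2 / Fintype.card T * energy G v := by
  have hT : (0 : ℝ) < Fintype.card T := by exact_mod_cast Fintype.card_pos
  have h1 := sum_sq_sub_le_energy G v Finset.univ (fun _ : T => k) (φ a)
    (fun e _ e' _ _ h => hinj h) (fun e _ => hadj e)
  have h2 := sq_sum_le_card_mul_sum_sq (s := (Finset.univ : Finset T)) (f := fun t => v k - v (φ a t))
  have e : v k - blockAvg φ v a = (∑ t, (v k - v (φ a t))) / Fintype.card T := by
    rw [blockAvg, Finset.sum_sub_distrib]
    simp
    field_simp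
  rw [e, div_pow, div_le_iff₀ (by positivity)]
  refine h2.trans ?_
  rw [Finset.card_univ]
  calc _ ≤ (Fintype.card T : ℝ) * (2 * energy G v) := by gcongr
    _ = _ := by field_simp

/-- A difference of two averages is the mean over `|T|²` pairs of nodes. By `hφ` and `hinj`
different coarse edges use different pairs, so their energies add up without overlap. -/
theorem sum_sq_blockAvg_sub_le (G : SimpleGraph V) (v : V → ℝ) (φ : P → T → V) (S : Set P)
    (hφ : ∀ a ∈ S, ∀ a' ∈ S, ∀ t t', φ a t = φ a' t' → a = a' ∧ t = t')
    {ι : Type*} (F : Finset ι) (x y : ι → P)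
    (hinj : ∀ e ∈ F, ∀ e' ∈ F, x e = x e' → y e = y e' → e = e')
    (hx : ∀ e ∈ F, x e ∈ S) (hy : ∀ e ∈ F, y e ∈ S)
    (hadj : ∀ e ∈ F, ∀ t t', φ (x e) t = φ (y e) t' ∨ G.Adj (φ (x e) t) (φ (y e) t')) :
    ∑ e ∈ F, (blockAvg φ v (x e) - blockAvg φ v (y e)) ^ 2 ≤
      2 / (Fintype.card T : ℝ) ^ 2 * energy G v := by
  have hT : (0 : ℝ) < Fintype.card T := by exact_mod_cast Fintype.card_pos
  have h1 := sum_sq_sub_le_energy G v (F ×ˢ (Finset.univ : Finset (T × T)))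
    (fun e => φ (x e.1) e.2.1) (fun e => φ (y e.1) e.2.2) (by
      rintro ⟨e, t, t'⟩ he ⟨e', s, s'⟩ he' h h'
      simp at he he'
      obtain ⟨h1, rfl⟩ := hφ _ (hx e he) _ (hx e' he') _ _ h
      obtain ⟨h2, rfl⟩ := hφ _ (hy e he) _ (hy e' he') _ _ h'
      rw [hinj e he e' he' h1 h2]) (by
      rintro ⟨e, t, t'⟩ he
      simp at he
      exact hadj e he t t')
  rw [Finset.sum_product] at h1
  have h2 : ∀ a b, (blockAvg φ v a - blockAvg φ v b) ^ 2 ≤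
      (∑ t : T × T, (v (φ a t.1) - v (φ b t.2)) ^ 2) / (Fintype.card T : ℝ) ^ 2 := by
    intro a b
    have e : blockAvg φ v a - blockAvg φ v b =
        (∑ t : T × T, (v (φ a t.1) - v (φ b t.2))) / (Fintype.card T : ℝ) ^ 2 := by
      rw [blockAvg, blockAvg, Fintype.sum_prod_type]
      simp only [Finset.sum_sub_distrib, Finset.sum_const, Finset.card_univ, nsmul_eq_mul,
        ← Finset.mul_sum]
      field_simp
    have h3 := sq_sum_le_card_mul_sum_sq (s := (Finset.univ : Finset (T × T)))
      (f := fun t => v (φ a t.1) - v (φ b t.2))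
    rw [Finset.card_univ, Fintype.card_prod] at h3
    rw [e, div_pow, div_le_div_iff₀ (by positivity) (by positivity)]
    push_cast at h3
    calc _ ≤ _ := mul_le_mul_of_nonneg_right h3 (by positivity)
      _ = _ := by ring
  calc _ ≤ ∑ e ∈ F, (∑ t : T × T, (v (φ (x e) t.1) - v (φ (y e) t.2)) ^ 2) /
        (Fintype.card T : ℝ) ^ 2 := Finset.sum_le_sum fun e _ => h2 _ _
    _ = (∑ e ∈ F, ∑ t : T × T, (v (φ (x e) t.1) - v (φ (y e) t.2)) ^ 2) /
        (Fintype.card T : ℝ) ^ 2 := by rw [Finset.sum_div]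
    _ ≤ (2 * energy G v) / (Fintype.card T : ℝ) ^ 2 := by gcongr
    _ = _ := by ring

end Coarse

/-! ### Arithmetic of blocks in an interval -/

section Blocks

/-- The index of the block of length `s` nearest to `x`, among the blocks that fit into
`0, …, m - 1`. -/
def blockIdx (m s x : ℕ) : ℕ := min (x / s) (m / s - 1)

variable {m s : ℕ}

theorem blockIdx_lt (hs : 1 ≤ s) (hsm : s ≤ m) (x : ℕ) : blockIdx m s x < m / s := by
  have := Nat.div_pos hsm hs
  unfold blockIdx
  omega

theorem block_lt {a t : ℕ} (ha : a < m / s) (ht : t < s) : a * s + t < m := by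
  have h1 : (a + 1) * s ≤ m := (Nat.mul_le_mul_right s ha).trans (Nat.div_mul_le_self m s)
  linarith [add_mul a 1 s]

theorem block_inj {a a' t t' : ℕ} (ht : t < s) (ht' : t' < s)
    (h : a * s + t = a' * s + t') : a = a' ∧ t = t' := by
  have hs : 0 < s := by omega
  have h1 : (a * s + t) / s = a := by
    rw [mul_comm, Nat.mul_add_div hs, Nat.div_eq_of_lt ht, add_zero]
  have h2 : (a' * s + t') / s = a' := by
    rw [mul_comm, Nat.mul_add_div hs, Nat.div_eq_of_lt ht', add_zero]
  have h3 : a = a' := by rw [← h1, ← h2, h]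
  subst h3
  exact ⟨rfl, by omega⟩

/-- Within its own block a point is at distance at most `s - 1`. The fewer than `s` leftover points
at the end are sent to the last full block, which gives `2 * s - 2`. -/
theorem blockIdx_near (hs : 1 ≤ s) (hsm : s ≤ m) {x : ℕ} (hx : x < m) {t : ℕ} (ht : t < s) :
    x ≤ blockIdx m s x * s + t + (2 * s - 2) ∧ blockIdx m s x * s + t ≤ x + (2 * s - 2) := by
  have hp := Nat.div_pos hsm hs
  have h1 := Nat.div_add_mod x s
  have h2 := Nat.mod_lt x hs
  have h3 := Nat.div_add_mod m s
  have h4 := Nat.mod_lt m hs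
  have h5 : x / s ≤ m / s := Nat.div_le_div_right hx.le
  rcases h5.lt_or_eq with h | h
  · have : blockIdx m s x = x / s := by unfold blockIdx; omega
    rw [this, mul_comm (x / s)]
    omega
  · have : blockIdx m s x = m / s - 1 := by unfold blockIdx; omega
    rw [this]
    rw [h] at h1
    have h6 : (m / s - 1) * s + s = s * (m / s) := by
      obtain ⟨q, hq⟩ : ∃ q, m / s = q + 1 := ⟨m / s - 1, by omega⟩
      rw [hq]; simp; ring
    omega

/-- Truncation by `min` does not increase distances, so only the rounding of the division costs the
extra 1. -/
theorem abs_blockIdx_sub_le (hs : 1 ≤ s) (x y : ℕ) :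
    |(blockIdx m s x : ℝ) - blockIdx m s y| ≤ |(x : ℝ) - y| / s + 1 := by
  wlog h : x ≤ y generalizing x y
  · rw [abs_sub_comm, abs_sub_comm (x : ℝ)]; exact this y x (by omega)
  have hs' : (0 : ℝ) < s := by exact_mod_cast hs
  have h1 : x / s ≤ y / s := Nat.div_le_div_right h
  have h2 : blockIdx m s x ≤ blockIdx m s y := by unfold blockIdx; omega
  have h3 : blockIdx m s y + x / s ≤ blockIdx m s x + y / s := by unfold blockIdx; omega
  have h3' : (blockIdx m s y : ℝ) + (x / s : ℕ) ≤ blockIdx m s x + (y / s : ℕ) := by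
    exact_mod_cast h3
  have h4 : ((y / s : ℕ) : ℝ) ≤ y / s := Nat.cast_div_le
  have h5 : (x : ℝ) / s < (x / s : ℕ) + 1 := by
    rw [div_lt_iff₀ hs']
    have := Nat.lt_mul_div_succ x hs
    have : x < (x / s + 1) * s := by linarith [mul_comm s (x / s + 1)]
    exact_mod_cast this
  rw [abs_sub_comm, abs_sub_comm (x : ℝ), abs_of_nonneg (by simpa using h2),
    abs_of_nonneg (by simpa using h), sub_div]
  linarith

theorem abs_natCast_sub_le {x y d : ℕ} (h1 : x ≤ y + d) (h2 : y ≤ x + d) :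
    |(x : ℝ) - y| ≤ d := by
  rw [abs_le]
  have h1' : (x : ℝ) ≤ y + d := by exact_mod_cast h1
  have h2' : (y : ℝ) ≤ x + d := by exact_mod_cast h2
  constructor <;> linarith

theorem val_ofNat {n : ℕ} [NeZero n] {x : ℕ} (h : x < n) : (Fin.ofNat n x : ℕ) = x := by
  simp [Nat.mod_eq_of_lt h]

end Blocks

/-! ### The one-dimensional grid -/

section OneDim

theorem grid1D_card_edges_le (n : ℕ) {r : ℝ} (hr : 1 ≤ r) :
    ((edges (grid1D n r)).card : ℝ) ≤ 2 * (n * r) := by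
  have h : (edges (grid1D n r)).card ≤
      ((Finset.univ : Finset (Fin n)) ×ˢ Finset.range (⌊r⌋₊ + 1)).card := by
    refine Finset.card_le_card_of_injOn (fun p => (p.1, (p.2 : ℕ) - p.1)) ?_ ?_
    · rintro ⟨i, j⟩ hp
      obtain ⟨hlt, -, hle⟩ := mem_edges.1 hp
      have hlt' : (i : ℕ) < j := hlt
      simp only [Finset.coe_product, Finset.coe_univ, Finset.coe_range, Set.mem_prod,
        Set.mem_univ, Set.mem_Iio, true_and]
      rw [Nat.lt_succ_iff]
      apply Nat.le_floor
      rw [Nat.cast_sub hlt'.le]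
      rw [abs_sub_comm] at hle
      exact (le_abs_self _).trans hle
    · rintro ⟨i, j⟩ hp ⟨i', j'⟩ hp' h
      have h1 : (i : ℕ) < j := (mem_edges.1 hp).1
      have h2 : (i' : ℕ) < j' := (mem_edges.1 hp').1
      simp only [Prod.mk.injEq] at h
      obtain ⟨rfl, h⟩ := h
      ext
      · rfl
      · simp only; omega
  have h' : ((edges (grid1D n r)).card : ℝ) ≤ n * (⌊r⌋₊ + 1) := by
    refine (Nat.cast_le.2 h).trans (le_of_eq ?_)
    simp
  have hf := Nat.floor_le (by linarith : 0 ≤ r)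
  calc _ ≤ (n : ℝ) * (⌊r⌋₊ + 1) := h'
    _ ≤ n * (2 * r) := by gcongr; linarith
    _ = _ := by ring

/-- The distance is kept explicit so that edges (`|k - l| ≤ r`) and arbitrary pairs (`|k - l| ≤ n`)
are both covered. -/
theorem grid1D_poincare {n : ℕ} {r : ℝ} (hr : 1 ≤ r) (hrn : r ≤ n) (v : Fin n → ℝ)
    (k l : Fin n) :
    (v k - v l) ^ 2 ≤ (72 / r + 384 * |(k : ℝ) - l| / r ^ 3) * energy (grid1D n r) v := by
  have hn : NeZero n := ⟨by have := k.2; omega⟩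
  obtain ⟨R, hR⟩ : ∃ R, R = ⌊r⌋₊ := ⟨_, rfl⟩
  have hRr : (R : ℝ) ≤ r := hR ▸ Nat.floor_le (by linarith)
  have hR1 : 1 ≤ R := hR ▸ Nat.le_floor (by simpa using hr)
  have hRn : R ≤ n := by exact_mod_cast hRr.trans hrn
  have hrR : r < R + 1 := hR ▸ Nat.lt_floor_add_one r
  -- Nodes of neighbouring blocks differ by at most `2 * s - 1`, which must not exceed `R`.
  obtain ⟨s, hs⟩ : ∃ s, s = (R + 1) / 2 := ⟨_, rfl⟩
  have hs1 : 1 ≤ s := by omega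
  have hsn : s ≤ n := by omega
  have hsR : 2 * s ≤ R + 1 := by omega
  have hrs : r ≤ 4 * s := by
    have : R + 1 ≤ 4 * s := by omega
    have : (R : ℝ) + 1 ≤ 4 * s := by exact_mod_cast this
    linarith
  have hne : Nonempty (Fin s) := ⟨⟨0, hs1⟩⟩
  have hs0 : (1 : ℝ) ≤ s := by exact_mod_cast hs1
  set E := energy (grid1D n r) v with hE
  have hE0 : 0 ≤ E := energy_nonneg _ _
  have hadj : ∀ x y : Fin n, (x : ℕ) ≤ y + R → (y : ℕ) ≤ x + R → x = y ∨ (grid1D n r).Adj x y := by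
    intro x y h1 h2
    refine or_iff_not_imp_left.2 fun h => ⟨h, (abs_natCast_sub_le h1 h2).trans hRr⟩
  -- `Fin.ofNat` reduces modulo `n`; for the block indices `a < n / s` in use there is no
  -- wraparound.
  let φ : ℕ → Fin s → Fin n := fun a t => Fin.ofNat n (a * s + t)
  have hφ : ∀ a < n / s, ∀ t, (φ a t : ℕ) = a * s + t := fun a ha t =>
    val_ofNat (block_lt ha t.2)
  have hφi : ∀ a ∈ {a | a < n / s}, ∀ a' ∈ {a | a < n / s}, ∀ t t',
      φ a t = φ a' t' → a = a' ∧ t = t' := by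
    intro a ha a' ha' t t' h
    have h := congrArg Fin.val h
    rw [hφ a ha, hφ a' ha'] at h
    obtain ⟨h1, h2⟩ := block_inj t.2 t'.2 h
    exact ⟨h1, Fin.ext h2⟩
  have hpt : ∀ x : Fin n, (v x - blockAvg φ v (blockIdx n s x)) ^ 2 ≤ 2 / s * E := by
    intro x
    have hb := blockIdx_lt hs1 hsn (x : ℕ)
    have := sq_sub_blockAvg_le (grid1D n r) v φ x (blockIdx n s x)
      (fun t t' h => (hφi _ hb _ hb _ _ h).2) (fun t => by
        have := blockIdx_near hs1 hsn x.2 t.2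
        apply hadj <;> rw [hφ _ hb] <;> omega)
    simpa using this
  have hpath := sq_sub_le_sum_sq (blockAvg φ v) (blockIdx_lt hs1 hsn (k : ℕ))
    (blockIdx_lt hs1 hsn (l : ℕ))
  have hco := sum_sq_blockAvg_sub_le (grid1D n r) v φ {a | a < n / s} hφi
    (Finset.range (n / s - 1)) (fun i => i) (fun i => i + 1) (fun _ _ _ _ h _ => h)
    (fun i hi => by simp at hi ⊢; omega) (fun i hi => by simp at hi ⊢; omega)
    (fun i hi t t' => by
      simp at hi
      have h1 := t.2
      have h2 := t'.2
      apply hadj <;> rw [hφ _ (by omega), hφ _ (by omega), add_mul] <;> omega)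
  rw [Fintype.card_fin] at hco
  have hd := abs_blockIdx_sub_le (m := n) hs1 (k : ℕ) (l : ℕ)
  have hmid : (blockAvg φ v (blockIdx n s k) - blockAvg φ v (blockIdx n s l)) ^ 2 ≤
      (|(k : ℝ) - l| / s + 1) * (2 / s ^ 2 * E) := by
    refine hpath.trans ?_
    gcongr
  have hk := hpt k
  have hl := hpt l
  have h3 : (v k - v l) ^ 2 ≤ 3 * (2 / s * E + (|(k : ℝ) - l| / s + 1) * (2 / s ^ 2 * E) +
      2 / s * E) := by
    set x := v k
    set y := v l
    set a := blockAvg φ v (blockIdx n s k)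
    set b := blockAvg φ v (blockIdx n s l)
    nlinarith [sq_nonneg ((x - a) - (a - b)), sq_nonneg ((x - a) - (b - y)),
      sq_nonneg ((a - b) - (b - y))]
  have hinv : 1 / (s : ℝ) ≤ 4 / r := by
    rw [div_le_div_iff₀ (by positivity) (by positivity)]; linarith
  have hinv2 : 1 / (s : ℝ) ^ 2 ≤ 1 / s := by
    gcongr; nlinarith
  have hinv3 : 1 / (s : ℝ) ^ 3 ≤ (4 / r) ^ 3 := by
    calc 1 / (s : ℝ) ^ 3 = (1 / (s : ℝ)) ^ 3 := by rw [div_pow, one_pow]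
      _ ≤ _ := by gcongr
  calc _ ≤ _ := h3
    _ = (12 * (1 / s) + 6 * (1 / (s : ℝ) ^ 2) + 6 * |(k : ℝ) - l| * (1 / (s : ℝ) ^ 3)) * E := by
        field_simp; ring
    _ ≤ (12 * (4 / r) + 6 * (4 / r) + 6 * |(k : ℝ) - l| * (4 / r) ^ 3) * E := by
        gcongr (12 * ?_ + 6 * ?_ + 6 * _ * ?_) * E
        exact hinv2.trans hinv
    _ = _ := by ring

end OneDim

/-! ### The two-dimensional grid -/

section TwoDim

theorem grid2D_card_edges_le (m : ℕ) {r : ℝ} (hr : 1 ≤ r) :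
    ((edges (grid2D m r)).card : ℝ) ≤ 9 * ((m : ℝ) ^ 2 * r ^ 2) := by
  obtain ⟨R, hR⟩ : ∃ R, R = ⌊r⌋₊ := ⟨_, rfl⟩
  have hRr : (R : ℝ) ≤ r := hR ▸ Nat.floor_le (by linarith)
  have hnear : ∀ {x y : ℕ}, |(x : ℝ) - y| ≤ r → x ≤ y + R ∧ y ≤ x + R := by
    intro x y h
    have key : ∀ {x y : ℕ}, (x : ℝ) - y ≤ r → x ≤ y + R := by
      intro x y h
      rcases le_total x y with h' | h'
      · omega
      · have : x - y ≤ R := hR ▸ Nat.le_floor (by rwa [Nat.cast_sub h'])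
        omega
    rw [abs_le] at h
    exact ⟨key h.2, key (by linarith)⟩
  have hnear' : ∀ p ∈ edges (grid2D m r),
      ((ofLex p.1).1 : ℕ) ≤ (ofLex p.2).1 + R ∧ ((ofLex p.2).1 : ℕ) ≤ (ofLex p.1).1 + R ∧
      ((ofLex p.1).2 : ℕ) ≤ (ofLex p.2).2 + R ∧ ((ofLex p.2).2 : ℕ) ≤ (ofLex p.1).2 + R := by
    intro p hp
    obtain ⟨-, -, h⟩ := mem_edges.1 hp
    have h1 := hnear ((le_add_of_nonneg_right (abs_nonneg _)).trans h)
    have h2 := hnear ((le_add_of_nonneg_left (abs_nonneg _)).trans h)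
    exact ⟨h1.1, h1.2, h2.1, h2.2⟩
  have h : (edges (grid2D m r)).card ≤ ((Finset.univ : Finset (Fin m ×ₗ Fin m)) ×ˢ
      (Finset.range (2 * R + 1) ×ˢ Finset.range (2 * R + 1))).card := by
    -- An edge is encoded by one end and its offset, shifted by `R` so that the subtraction in `ℕ`
    -- is never truncated.
    refine Finset.card_le_card_of_injOn (fun p => (p.1,
      ((ofLex p.2).1 : ℕ) + R - (ofLex p.1).1, ((ofLex p.2).2 : ℕ) + R - (ofLex p.1).2)) ?_ ?_
    · intro p hp
      have := hnear' p hp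
      simp only [Finset.coe_product, Finset.coe_univ, Finset.coe_range, Set.mem_prod,
        Set.mem_univ, Set.mem_Iio, true_and]
      omega
    · rintro ⟨i, j⟩ hp ⟨i', j'⟩ hp' h
      have h1 := hnear' _ hp
      have h2 := hnear' _ hp'
      simp only [Prod.mk.injEq] at h h1 h2 ⊢
      obtain ⟨rfl, h3, h4⟩ := h
      refine ⟨rfl, ofLex.injective (Prod.ext (Fin.ext ?_) (Fin.ext ?_))⟩ <;> omega
  have h' : ((edges (grid2D m r)).card : ℝ) ≤ (m : ℝ) ^ 2 * (2 * R + 1) ^ 2 := by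
    refine (Nat.cast_le.2 h).trans (le_of_eq ?_)
    rw [Finset.card_product, Finset.card_product, Finset.card_univ, Finset.card_range,
      Fintype.card_congr (ofLex : Fin m ×ₗ Fin m ≃ Fin m × Fin m), Fintype.card_prod,
      Fintype.card_fin]
    push_cast
    ring
  calc _ ≤ _ := h'
    _ ≤ (m : ℝ) ^ 2 * (3 * r) ^ 2 := by gcongr; linarith
    _ = _ := by ring

/-- Coarse graining: a Poincaré type inequality on the grid of blocks gives one on the
two-dimensional grid. -/
theorem grid2D_poincare_of_coarse {m : ℕ} {r : ℝ} (hr : 1 ≤ r) (hrm : r ≤ 2 * m)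
    (v : Fin m ×ₗ Fin m → ℝ) {k l : Fin m ×ₗ Fin m} (hkl : k ≠ l) :
    ∃ s : ℕ, 1 ≤ s ∧ s ≤ m ∧ r ≤ 4 * s ∧ ∀ B : ℝ, 0 ≤ B →
      (∀ u : ℕ → ℕ → ℝ,
        (u (blockIdx m s (ofLex k).1) (blockIdx m s (ofLex k).2) -
          u (blockIdx m s (ofLex l).1) (blockIdx m s (ofLex l).2)) ^ 2 ≤
            B * gridEnergy (m / s) u) →
      (v k - v l) ^ 2 ≤ (192 / r ^ 2 + B * (12 * (1 / (s : ℝ) ^ 4))) * energy (grid2D m r) v := by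
  have hm : NeZero m := ⟨by have := (ofLex k).1.2; omega⟩
  have hm2 : 2 ≤ m := by
    by_contra h
    have := NeZero.pos m
    have h1 := (ofLex k).1.2
    have h2 := (ofLex k).2.2
    have h3 := (ofLex l).1.2
    have h4 := (ofLex l).2.2
    exact hkl (ofLex.injective (Prod.ext (Fin.ext (by omega)) (Fin.ext (by omega))))
  obtain ⟨R, hR⟩ : ∃ R, R = ⌊r⌋₊ := ⟨_, rfl⟩
  have hRr : (R : ℝ) ≤ r := hR ▸ Nat.floor_le (by linarith)
  have hR1 : 1 ≤ R := hR ▸ Nat.le_floor (by simpa using hr)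
  have hRm : R ≤ 2 * m := by exact_mod_cast hRr.trans hrm
  have hrR : r < R + 1 := hR ▸ Nat.lt_floor_add_one r
  -- Two conditions in the `ℓ¹` distance: `2 * (2 * s - 2) ≤ R` joins a node to its nearest block,
  -- and `(2 * s - 1) + (s - 1) ≤ R` joins neighbouring blocks.
  obtain ⟨s, hs⟩ : ∃ s, s = R / 4 + 1 := ⟨_, rfl⟩
  have hs1 : 1 ≤ s := by omega
  have hsm : s ≤ m := by omega
  have hsR : 4 * s ≤ R + 4 := by omega
  have hsR' : 3 * s ≤ R + 2 := by omega
  have hrs : r ≤ 4 * s := by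
    have : R + 1 ≤ 4 * s := by omega
    have : (R : ℝ) + 1 ≤ 4 * s := by exact_mod_cast this
    linarith
  refine ⟨s, hs1, hsm, hrs, fun B hB hu => ?_⟩
  have hne : Nonempty (Fin s) := ⟨⟨0, hs1⟩⟩
  have hs0 : (1 : ℝ) ≤ s := by exact_mod_cast hs1
  set E := energy (grid2D m r) v with hE
  have hE0 : 0 ≤ E := energy_nonneg _ _
  have hadj : ∀ (x y : Fin m ×ₗ Fin m) (d d' : ℕ), d + d' ≤ R →
      ((ofLex x).1 : ℕ) ≤ (ofLex y).1 + d → ((ofLex y).1 : ℕ) ≤ (ofLex x).1 + d →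
      ((ofLex x).2 : ℕ) ≤ (ofLex y).2 + d' → ((ofLex y).2 : ℕ) ≤ (ofLex x).2 + d' →
      x = y ∨ (grid2D m r).Adj x y := by
    intro x y d d' hd h1 h2 h3 h4
    refine or_iff_not_imp_left.2 fun h => ⟨h, ?_⟩
    have hd' : (d : ℝ) + d' ≤ R := by exact_mod_cast hd
    linarith [abs_natCast_sub_le h1 h2, abs_natCast_sub_le h3 h4]
  let φ : ℕ × ℕ → Fin s × Fin s → Fin m ×ₗ Fin m := fun a t =>
    toLex (Fin.ofNat m (a.1 * s + t.1), Fin.ofNat m (a.2 * s + t.2))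
  have hφ1 : ∀ a b, a < m / s → ∀ t, ((ofLex (φ (a, b) t)).1 : ℕ) = a * s + t.1 :=
    fun a b ha t => val_ofNat (block_lt ha t.1.2)
  have hφ2 : ∀ a b, b < m / s → ∀ t, ((ofLex (φ (a, b) t)).2 : ℕ) = b * s + t.2 :=
    fun a b hb t => val_ofNat (block_lt hb t.2.2)
  set S : Set (ℕ × ℕ) := {a | a.1 < m / s ∧ a.2 < m / s} with hS
  have hφi : ∀ a ∈ S, ∀ a' ∈ S, ∀ t t', φ a t = φ a' t' → a = a' ∧ t = t' := by
    rintro ⟨a, b⟩ ⟨ha, hb⟩ ⟨a', b'⟩ ⟨ha', hb'⟩ t t' h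
    have h1 := congrArg (fun x => ((ofLex x).1 : ℕ)) h
    have h2 := congrArg (fun x => ((ofLex x).2 : ℕ)) h
    rw [hφ1 a b ha, hφ1 a' b' ha'] at h1
    rw [hφ2 a b hb, hφ2 a' b' hb'] at h2
    obtain ⟨h3, h4⟩ := block_inj t.1.2 t'.1.2 h1
    obtain ⟨h5, h6⟩ := block_inj t.2.2 t'.2.2 h2
    exact ⟨Prod.ext h3 h5, Prod.ext (Fin.ext h4) (Fin.ext h6)⟩
  let u : ℕ → ℕ → ℝ := fun a b => blockAvg φ v (a, b)
  have hpt : ∀ x : Fin m ×ₗ Fin m,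
      (v x - u (blockIdx m s (ofLex x).1) (blockIdx m s (ofLex x).2)) ^ 2 ≤ 2 / s ^ 2 * E := by
    intro x
    have hb1 := blockIdx_lt hs1 hsm ((ofLex x).1 : ℕ)
    have hb2 := blockIdx_lt hs1 hsm ((ofLex x).2 : ℕ)
    have := sq_sub_blockAvg_le (grid2D m r) v φ x
      (blockIdx m s (ofLex x).1, blockIdx m s (ofLex x).2)
      (fun t t' h => (hφi _ ⟨hb1, hb2⟩ _ ⟨hb1, hb2⟩ _ _ h).2) (fun t => by
        have h1 := blockIdx_near hs1 hsm (ofLex x).1.2 t.1.2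
        have h2 := blockIdx_near hs1 hsm (ofLex x).2.2 t.2.2
        apply hadj _ _ (2 * s - 2) (2 * s - 2) (by omega) <;>
          first | rw [hφ1 _ _ hb1] | rw [hφ2 _ _ hb2]
        all_goals omega)
    simpa [← pow_two] using this
  have hco : gridEnergy (m / s) u ≤ 4 * (1 / (s : ℝ) ^ 4) * E := by
    have h1 := sum_sq_blockAvg_sub_le (grid2D m r) v φ S hφi
      (Finset.range (m / s - 1) ×ˢ Finset.range (m / s)) (fun i => i) (fun i => (i.1 + 1, i.2))
      (fun _ _ _ _ h _ => h)
      (fun i hi => by simp [hS] at hi ⊢; omega) (fun i hi => by simp [hS] at hi ⊢; omega)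
      (fun i hi t t' => by
        simp at hi
        have h1 := t.1.2
        have h2 := t'.1.2
        have h3 := t.2.2
        have h4 := t'.2.2
        apply hadj _ _ (2 * s - 1) (s - 1) (by omega) <;>
          first
            | rw [hφ1 _ _ (by omega), hφ1 _ _ (by omega)]
            | rw [hφ2 _ _ (by omega), hφ2 _ _ (by omega)]
        all_goals try rw [add_mul]
        all_goals omega)
    have h2 := sum_sq_blockAvg_sub_le (grid2D m r) v φ S hφi
      (Finset.range (m / s) ×ˢ Finset.range (m / s - 1)) (fun i => i) (fun i => (i.1, i.2 + 1))
      (fun _ _ _ _ h _ => h)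
      (fun i hi => by simp [hS] at hi ⊢; omega) (fun i hi => by simp [hS] at hi ⊢; omega)
      (fun i hi t t' => by
        simp at hi
        have h1 := t.1.2
        have h2 := t'.1.2
        have h3 := t.2.2
        have h4 := t'.2.2
        apply hadj _ _ (s - 1) (2 * s - 1) (by omega) <;>
          first
            | rw [hφ1 _ _ (by omega), hφ1 _ _ (by omega)]
            | rw [hφ2 _ _ (by omega), hφ2 _ _ (by omega)]
        all_goals try rw [add_mul]
        all_goals omega)
    rw [Finset.sum_product] at h1 h2
    rw [Fintype.card_prod, Fintype.card_fin] at h1 h2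
    refine (add_le_add h1 h2).trans (le_of_eq ?_)
    push_cast
    field_simp
    ring
  have hmid := (hu u).trans (mul_le_mul_of_nonneg_left hco hB)
  have hk := hpt k
  have hl := hpt l
  have h3 : (v k - v l) ^ 2 ≤ 3 * (2 / s ^ 2 * E + B * (4 * (1 / (s : ℝ) ^ 4) * E) +
      2 / s ^ 2 * E) := by
    set x := v k
    set y := v l
    set a := u (blockIdx m s (ofLex k).1) (blockIdx m s (ofLex k).2)
    set b := u (blockIdx m s (ofLex l).1) (blockIdx m s (ofLex l).2)
    nlinarith [sq_nonneg ((x - a) - (a - b)), sq_nonneg ((x - a) - (b - y)),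
      sq_nonneg ((a - b) - (b - y))]
  have hinv : 1 / (s : ℝ) ≤ 4 / r := by
    rw [div_le_div_iff₀ (by positivity) (by positivity)]; linarith
  calc _ ≤ _ := h3
    _ = (12 * (1 / (s : ℝ)) ^ 2 + B * (12 * (1 / (s : ℝ) ^ 4))) * E := by
        field_simp; ring
    _ ≤ (12 * (4 / r) ^ 2 + B * (12 * (1 / (s : ℝ) ^ 4))) * E := by gcongr
    _ = _ := by ring

/-- The blocks of adjacent nodes are at `ℓ¹` distance at most `r / s + 2 ≤ 6`, so the path bound
applies with a constant. -/
theorem grid2D_poincare_adj {m : ℕ} {r : ℝ} (hr : 1 ≤ r) (hrm : r ≤ 2 * m)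
    (v : Fin m ×ₗ Fin m → ℝ) {k l : Fin m ×ₗ Fin m} (hkl : (grid2D m r).Adj k l) :
    (v k - v l) ^ 2 ≤ 4032 / r ^ 2 * energy (grid2D m r) v := by
  obtain ⟨s, hs1, hsm, hrs, h⟩ := grid2D_poincare_of_coarse hr hrm v hkl.1
  have hs0 : (1 : ℝ) ≤ s := by exact_mod_cast hs1
  have hE0 := energy_nonneg (grid2D m r) v
  refine (h 20 (by norm_num) fun u => ?_).trans ?_
  · refine (gridEnergy_path u (blockIdx_lt hs1 hsm _) (blockIdx_lt hs1 hsm _)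
      (blockIdx_lt hs1 hsm _) (blockIdx_lt hs1 hsm _)).trans ?_
    have hE := gridEnergy_nonneg (m / s) u
    have hd := hkl.2
    have h1 := abs_blockIdx_sub_le (m := m) hs1 ((ofLex k).1 : ℕ) ((ofLex l).1 : ℕ)
    have h2 := abs_blockIdx_sub_le (m := m) hs1 ((ofLex k).2 : ℕ) ((ofLex l).2 : ℕ)
    have h3 : (|(((ofLex k).1 : ℕ) : ℝ) - (((ofLex l).1 : ℕ) : ℝ)| +
      |(((ofLex k).2 : ℕ) : ℝ) - (((ofLex l).2 : ℕ) : ℝ)|) / s ≤ 4 := by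
      rw [div_le_iff₀ (by positivity)]
      exact hd.trans hrs
    rw [add_div] at h3
    gcongr
    linarith
  · gcongr
    have hinv : 1 / (s : ℝ) ≤ 4 / r := by
      rw [div_le_div_iff₀ (by positivity) (by positivity)]; linarith
    have hinv4 : 1 / (s : ℝ) ^ 4 ≤ (4 / r) ^ 2 := by
      calc 1 / (s : ℝ) ^ 4 ≤ 1 / (s : ℝ) ^ 2 := by
            gcongr 1 / ?_
            exact pow_le_pow_right₀ hs0 (by norm_num)
        _ = (1 / (s : ℝ)) ^ 2 := by rw [div_pow, one_pow]
        _ ≤ _ := by gcongr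
    calc 192 / r ^ 2 + 20 * (12 * (1 / (s : ℝ) ^ 4))
        ≤ 192 / r ^ 2 + 20 * (12 * (4 / r) ^ 2) := by gcongr
      _ = _ := by ring

theorem grid2D_poincare {m : ℕ} {r : ℝ} (hr : 1 ≤ r) (hrm : r ≤ 2 * m)
    (v : Fin m ×ₗ Fin m → ℝ) {k l : Fin m ×ₗ Fin m} (hkl : k ≠ l) :
    (v k - v l) ^ 2 ≤
      307200 * (1 / r ^ 2 * (Real.log m / r ^ 2 + 1)) * energy (grid2D m r) v := by
  obtain ⟨s, hs1, hsm, hrs, h⟩ := grid2D_poincare_of_coarse hr hrm v hkl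
  have hs0 : (1 : ℝ) ≤ s := by exact_mod_cast hs1
  have hE0 := energy_nonneg (grid2D m r) v
  have hlog := Real.log_natCast_nonneg m
  refine (h (100 * (1 + Real.log m)) (by positivity) fun u => ?_).trans ?_
  · refine (gridEnergy_log u (blockIdx_lt hs1 hsm _) (blockIdx_lt hs1 hsm _)
      (blockIdx_lt hs1 hsm _) (blockIdx_lt hs1 hsm _)).trans ?_
    have hE := gridEnergy_nonneg (m / s) u
    have hpos : 0 < m / s := Nat.div_pos hsm hs1
    gcongr
    exact Nat.div_le_self m s
  · gcongr
    have hinv : 1 / (s : ℝ) ≤ 4 / r := by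
      rw [div_le_div_iff₀ (by positivity) (by positivity)]; linarith
    have hinv4 : 1 / (s : ℝ) ^ 4 ≤ (4 / r) ^ 4 := by
      calc 1 / (s : ℝ) ^ 4 = (1 / (s : ℝ)) ^ 4 := by rw [div_pow, one_pow]
        _ ≤ _ := by gcongr
    -- The constant term needs only `r⁻²`, while the logarithmic term keeps the full `r⁻⁴` of
    -- `hinv4`.
    have hinv2 : 1 / (s : ℝ) ^ 4 ≤ (4 / r) ^ 2 := by
      calc 1 / (s : ℝ) ^ 4 ≤ 1 / (s : ℝ) ^ 2 := by
            gcongr 1 / ?_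
            exact pow_le_pow_right₀ hs0 (by norm_num)
        _ = (1 / (s : ℝ)) ^ 2 := by rw [div_pow, one_pow]
        _ ≤ _ := by gcongr
    calc 192 / r ^ 2 + 100 * (1 + Real.log m) * (12 * (1 / (s : ℝ) ^ 4))
        = 192 / r ^ 2 + 1200 * (1 / (s : ℝ) ^ 4) + 1200 * Real.log m * (1 / (s : ℝ) ^ 4) := by
          ring
      _ ≤ 192 / r ^ 2 + 1200 * (4 / r) ^ 2 + 1200 * Real.log m * (4 / r) ^ 4 := by gcongr
      _ = 19392 / r ^ 2 + 307200 * Real.log m / r ^ 4 := by ring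
      _ ≤ 307200 / r ^ 2 + 307200 * Real.log m / r ^ 4 := by gcongr; norm_num
      _ = _ := by field_simp; ring

end TwoDim

end BTL

/-! ### Choice of constants and conclusion -/

theorem mainTheorem3 :
    ∃ C : ℝ, 0 < C ∧
      (∀ (n : ℕ) (r : ℝ) (L : ℕ) (κE : ℝ) (θ : Fin n → ℝ),
        1 ≤ r → r ≤ (n : ℝ) → 1 ≤ L → 1 ≤ κE →
        (∀ i j, (BTL.grid1D n r).Adj i j → |θ i - θ j| ≤ Real.log κE) →
        ∀ k l : Fin n, k ≠ l →
          ((BTL.grid1D n r).Adj k l →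
            BTL.effRes (BTL.grid1D n r) (fun _ _ => L) θ k l ≤ C * (1 / r * (κE / (L : ℝ))) ∧
            BTL.aggVolt (BTL.grid1D n r) (fun _ _ => L) θ k l
              ≤ C * (κE ^ (3 / 2 : ℝ) * Real.sqrt (n : ℝ))) ∧
          (¬ (BTL.grid1D n r).Adj k l →
            BTL.effRes (BTL.grid1D n r) (fun _ _ => L) θ k l
              ≤ C * (1 / r * (κE / (L : ℝ)) * ((n : ℝ) / r ^ 2 + 1)) ∧
            BTL.aggVolt (BTL.grid1D n r) (fun _ _ => L) θ k l
              ≤ C * (κE ^ (3 / 2 : ℝ) * Real.sqrt (n : ℝ)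
                  * Real.sqrt ((n : ℝ) / r ^ 2 + 1)))) ∧
      (∀ (n m : ℕ) (r : ℝ) (L : ℕ) (κE : ℝ) (θ : Fin m ×ₗ Fin m → ℝ),
        n = m ^ 2 →
        1 ≤ r → r ≤ 2 * Real.sqrt (n : ℝ) → 1 ≤ L → 1 ≤ κE →
        (∀ i j, (BTL.grid2D m r).Adj i j → |θ i - θ j| ≤ Real.log κE) →
        ∀ k l : Fin m ×ₗ Fin m, k ≠ l →
          ((BTL.grid2D m r).Adj k l →
            BTL.effRes (BTL.grid2D m r) (fun _ _ => L) θ k l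
              ≤ C * (1 / r ^ 2 * (κE / (L : ℝ))) ∧
            BTL.aggVolt (BTL.grid2D m r) (fun _ _ => L) θ k l
              ≤ C * (κE ^ (3 / 2 : ℝ) * Real.sqrt (n : ℝ))) ∧
          (¬ (BTL.grid2D m r).Adj k l →
            BTL.effRes (BTL.grid2D m r) (fun _ _ => L) θ k l
              ≤ C * (1 / r ^ 2 * (κE / (L : ℝ)) * (Real.log (n : ℝ) / r ^ 2 + 1)) ∧
            BTL.aggVolt (BTL.grid2D m r) (fun _ _ => L) θ k l
              ≤ C * (κE ^ (3 / 2 : ℝ) * Real.sqrt (n : ℝ)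
                  * Real.sqrt (Real.log (n : ℝ) / r ^ 2 + 1)))) := by

  have hdiv : ∀ a r E : ℝ, 0 ≤ E → 1 ≤ r → a ≤ 307200 → a / r * E ≤ 307200 * (1 / r * 1) * E := by
    intro a r E hE hr ha
    have : a / r * E ≤ 307200 / r * E := by gcongr
    exact this.trans (le_of_eq (by ring))
  -- 307200 is the largest of the Poincaré and edge-count constants; the 4 comes from `σ' ≥ 1 /
  -- (4κ)`.
  refine ⟨4 * 307200, by norm_num, ?_, ?_⟩
  · intro n r L κ θ hr hrn hL hκ hθ k l _
    have hcard : ((BTL.edges (BTL.grid1D n r)).card : ℝ) ≤ 307200 * (n * r) := by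
      refine (BTL.grid1D_card_edges_le n hr).trans ?_
      gcongr
      norm_num
    constructor
    · intro hadj
      have := BTL.effRes_le_and_aggVolt_le (BTL.grid1D n r) L κ θ k l hL hκ hθ
        (c := 307200) (ρ := r) (X := 1) (n := n) (by norm_num) (by positivity) (by norm_num)
        (by positivity) hcard (fun v => by
          have hE := BTL.energy_nonneg (BTL.grid1D n r) v
          refine (BTL.grid1D_poincare hr hrn v k l).trans (le_trans ?_
            (hdiv (72 + 384) r _ hE hr (by norm_num)))
          gcongr
          calc 72 / r + 384 * |(k : ℝ) - l| / r ^ 3 ≤ 72 / r + 384 * r / r ^ 3 := by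
                gcongr; exact hadj.2
            _ = 72 / r + 384 / r ^ 2 := by field_simp
            _ ≤ 72 / r + 384 / r := by gcongr; nlinarith
            _ = _ := by ring)
      simpa using this
    · intro _
      have := BTL.effRes_le_and_aggVolt_le (BTL.grid1D n r) L κ θ k l hL hκ hθ
        (c := 307200) (ρ := r) (X := n / r ^ 2 + 1) (n := n) (by norm_num) (by positivity)
        (by positivity) (by positivity) hcard (fun v => by
          have hE := BTL.energy_nonneg (BTL.grid1D n r) v
          refine (BTL.grid1D_poincare hr hrn v k l).trans ?_
          gcongr
          have hkl : |(k : ℝ) - l| ≤ n := BTL.abs_natCast_sub_le (by omega) (by omega)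
          calc 72 / r + 384 * |(k : ℝ) - l| / r ^ 3 ≤ 307200 / r + 307200 * n / r ^ 3 := by
                gcongr <;> norm_num
            _ = _ := by field_simp; ring)
      exact this
  · intro n m r L κ θ hnm hr hrn hL hκ hθ k l hkl
    have hn : (n : ℝ) = (m : ℝ) ^ 2 := by exact_mod_cast hnm
    have hrm : r ≤ 2 * m := by
      rwa [hn, Real.sqrt_sq (by positivity)] at hrn
    have hr2 : 1 ≤ r ^ 2 := by nlinarith
    have hcard : ((BTL.edges (BTL.grid2D m r)).card : ℝ) ≤ 307200 * (n * r ^ 2) := by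
      refine (BTL.grid2D_card_edges_le m hr).trans ?_
      rw [hn]
      gcongr
      norm_num
    constructor
    · intro hadj
      have := BTL.effRes_le_and_aggVolt_le (BTL.grid2D m r) L κ θ k l hL hκ hθ
        (c := 307200) (ρ := r ^ 2) (X := 1) (n := n) (by norm_num) (by positivity) (by norm_num)
        (by positivity) hcard (fun v =>
          (BTL.grid2D_poincare_adj hr hrm v hadj).trans
            (hdiv 4032 (r ^ 2) _ (BTL.energy_nonneg _ v) hr2 (by norm_num)))
      simpa using this
    · intro _
      have hm0 : 0 < m := by have := (ofLex k).1.2; omega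
      have hlog : Real.log m ≤ Real.log n := by
        apply Real.log_le_log (by exact_mod_cast hm0)
        rw [hn]
        have : (1 : ℝ) ≤ m := by exact_mod_cast hm0
        nlinarith
      have hlog0 := Real.log_natCast_nonneg n
      exact BTL.effRes_le_and_aggVolt_le (BTL.grid2D m r) L κ θ k l hL hκ hθ
        (c := 307200) (ρ := r ^ 2) (X := Real.log n / r ^ 2 + 1) (n := n) (by norm_num)
        (by positivity) (by positivity) (by positivity) hcard (fun v => by
          have hE := BTL.energy_nonneg (BTL.grid2D m r) v
          refine (BTL.grid2D_poincare hr hrm v hkl).trans ?_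
          gcongr)
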